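/- Let $\Omega\subset\mathbb{R}^n$ be nonempty, closed and convex, and let $F:\Omega\to\mathbb{R}^n$ be continuous and monotone, i.e. $\langle F(x)-F(y),x-y\rangle\ge 0$ for all $x,y\in\Omega$. Let $S_0=\{\bar x\in\Omega:\ \langle F(\bar x),y-\bar x\rangle\ge 0\ \ \forall y\in\Omega\}$ be the solution set of the variational inequality $\mathrm{VI}(F,\Omega)$, and assume that $S_0$ is nonempty and closed. Let $\varphi:\mathbb{R}^n\to(-\infty,+\infty]$ be a convex function that is finite on $\Omega$ and whose restriction to $\Omega$ is continuous (for instance a continuous convex function $\varphi:\Omega\to\mathbb{R}$, extended by $+\infty$ outside $\Omega$). Let $\partial\varphi(x)=\{v\in\mathbb{R}^n:\ \varphi(y)\ge\varphi(x)+\langle v,y-x\rangle\ \ \forall y\in\mathbb{R}^n\}$ if $\varphi(x)<+\infty$ and $\partial\varphi(x)=\emptyset$ otherwise, and let $\operatorname{dom}\partial\varphi=\{x:\partial\varphi(x)\neq\emptyset\}$. Assume that $$0\in\operatorname{ri}(\operatorname{dom}\partial\varphi-\Omega)\qquad\text{and}\qquad 0\in\operatorname{ri}(\operatorname{dom}\partial\varphi-S_0),$$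 where $\operatorname{ri}$ denotes the relative interior (the interior relative to the affine hull) and $A-B=\{a-b: a\in A,\ b\in B\}$. Let $$S_\varphi=\{\bar x\in S_0:\ \exists v\in\partial\varphi(\bar x)\ \text{ with }\ \langle v,x-\bar x\rangle\ge 0\ \ \forall x\in S_0\}$$ be the solution set of the generalized variational inequality $\mathrm{GVI}(\partial\varphi,S_0)$, and let $S_0^\infty=\{w\in\mathbb{R}^n:\ x+\tau w\in S_0\ \ \forall x\in S_0,\ \forall\tau\ge 0\}$ be the recession cone of $S_0$. Then $S_\varphi=\operatorname{argmin}_{S_0}\varphi$. Moreover, $S_\varphi$ is nonempty, bounded and convex if and only if for every $w\in S_0^\infty\setminus\{0\}$ there are $x\in S_0$ and $v\in\partial\varphi(x)$ with $\langle v,w\rangle>0$. -/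

import Mathlib

open scoped Pointwise

namespace VarIneq

variable {n : ℕ}

/-- `F` is monotone on `Ω`: `⟨F x - F y, x - y⟩ ≥ 0` for all `x, y ∈ Ω`. -/
def MonotoneMapOn (F : EuclideanSpace ℝ (Fin n) → EuclideanSpace ℝ (Fin n))
    (Ω : Set (EuclideanSpace ℝ (Fin n))) : Prop :=
  ∀ x ∈ Ω, ∀ y ∈ Ω, 0 ≤ inner ℝ (F x - F y) (x - y)

/-- Solution set of the variational inequality `VI(F, Ω)`. -/
def solVI (F : EuclideanSpace ℝ (Fin n) → EuclideanSpace ℝ (Fin n))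
    (Ω : Set (EuclideanSpace ℝ (Fin n))) : Set (EuclideanSpace ℝ (Fin n)) :=
  {x | x ∈ Ω ∧ ∀ y ∈ Ω, 0 ≤ inner ℝ (F x) (y - x)}

/-- Solution set of the (strong) generalized variational inequality `GVI(T, Ω)` of a
set-valued map `T`. -/
def solGVI (T : EuclideanSpace ℝ (Fin n) → Set (EuclideanSpace ℝ (Fin n)))
    (Ω : Set (EuclideanSpace ℝ (Fin n))) : Set (EuclideanSpace ℝ (Fin n)) :=
  {x | x ∈ Ω ∧ ∃ v ∈ T x, ∀ y ∈ Ω, 0 ≤ inner ℝ v (y - x)}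

/-- Recession (asymptotic) cone of `Ω`. -/
def recessionCone (Ω : Set (EuclideanSpace ℝ (Fin n))) : Set (EuclideanSpace ℝ (Fin n)) :=
  {w | ∀ x ∈ Ω, ∀ τ : ℝ, 0 ≤ τ → x + τ • w ∈ Ω}

/-- Convex subdifferential at `x` of the extended-valued function that equals `φ` on its effective
domain `D` and `+∞` outside `D`. It is empty at points outside `D`. -/
def subdiff (D : Set (EuclideanSpace ℝ (Fin n))) (φ : EuclideanSpace ℝ (Fin n) → ℝ)
    (x : EuclideanSpace ℝ (Fin n)) : Set (EuclideanSpace ℝ (Fin n)) :=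
  {v | x ∈ D ∧ ∀ y ∈ D, φ x + inner ℝ v (y - x) ≤ φ y}

/-- Domain of a set-valued map. -/
def svDom (T : EuclideanSpace ℝ (Fin n) → Set (EuclideanSpace ℝ (Fin n))) :
    Set (EuclideanSpace ℝ (Fin n)) :=
  {x | (T x).Nonempty}

/-- Set of minimizers of `φ` over `S`. -/
def argminOn (φ : EuclideanSpace ℝ (Fin n) → ℝ) (S : Set (EuclideanSpace ℝ (Fin n))) :
    Set (EuclideanSpace ℝ (Fin n)) :=
  {x | x ∈ S ∧ ∀ y ∈ S, φ x ≤ φ y}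

end VarIneq

/-! By Minty's lemma the solution set `S` of the variational inequality is `Ω` cut by half-spaces,
hence convex. If `x` minimizes `φ` over `S`, a positive extension of `(0, t) ↦ t` over the cone of
pairs `(d - s, t)` gives `v` with `φ x + ⟪v, d - s⟫ ≤ φ d` (`exists_multiplier`): `s = x` makes `v`
a subgradient, `d = x` makes `-v` normal to `S`. The qualification condition makes that cone project
onto a subspace, as the extension requires.

A subgradient with `⟪v, w⟫ > 0` confines each sublevel set to a half-space that does not recede
along `w`, so sublevel sets are bounded. If no such subgradient exists, `φ` does not increase along
`w`, and the minimizers contain a ray. Boundary points may lack subgradients; they are approached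
from the relative interior. -/

open Filter Topology

namespace VarIneq

/-! ### Relative algebraic interiors and multipliers -/

section Convexity

variable {E : Type*} [NormedAddCommGroup E] [InnerProductSpace ℝ E]

/-- `x` is in the relative algebraic interior of `D`: every segment in `D` ending at `x` can be
prolonged beyond `x` inside `D`. -/
def RelCore (D : Set E) (x : E) : Prop :=
  x ∈ D ∧ ∀ d ∈ D, ∃ ε : ℝ, 0 < ε ∧ x + ε • (x - d) ∈ D

/-- A half-open segment from a relative algebraic interior point to a point of a convex set consists
of relative algebraic interior points. -/
theorem RelCore.combo {D : Set E} (hD : Convex ℝ D) {x d : E} (hx : RelCore D x) (hd : d ∈ D)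
    {a b : ℝ} (ha : 0 < a) (hb : 0 ≤ b) (hab : a + b = 1) : RelCore D (a • x + b • d) := by
  refine ⟨hD hx.1 hd ha.le hb hab, fun e he => ?_⟩
  obtain ⟨ε, hε, hp⟩ := hx.2 e he
  have hk : 0 < 1 + ε * b := by positivity
  refine ⟨a * ε / (1 + ε * b), by positivity, ?_⟩
  -- The ray from `e` through `a • x + b • d` leaves that point and meets the segment from `x + ε •
  -- (x - e)` to `d`, here.
  have := hD hp hd (a := a / (1 + ε * b)) (b := (1 + ε) * b / (1 + ε * b))
    (by positivity) (by positivity) (by field_simp; linear_combination hab)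
  convert this using 1
  obtain rfl : b = 1 - a := by linarith
  match_scalars <;> field_simp <;> ring

/-- Moving from a point of the intrinsic interior in a direction of the affine span stays in the set
for a short time. -/
theorem exists_pos_add_smul_mem_of_mem_intrinsicInterior {A : Set E} {x y : E}
    (hx : x ∈ intrinsicInterior ℝ A) (hy : y ∈ affineSpan ℝ A) :
    ∃ ε : ℝ, 0 < ε ∧ x + ε • (x - y) ∈ A := by
  obtain ⟨z, hz, rfl⟩ := mem_intrinsicInterior.1 hx
  let f : ℝ → affineSpan ℝ A := fun t =>
    ⟨AffineMap.lineMap (z : E) y (-t), AffineMap.lineMap_mem _ z.2 hy⟩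
  have hf : Continuous f := by
    refine Continuous.subtype_mk ?_ _
    simp only [AffineMap.lineMap_apply]
    fun_prop
  have hf0 : f 0 = z := by
    ext1; simp [f]
  have hev : ∀ᶠ t in 𝓝 (0 : ℝ), f t ∈ interior ((↑) ⁻¹' A : Set <| affineSpan ℝ A) :=
    hf.continuousAt.eventually_mem (isOpen_interior.mem_nhds (by rw [hf0]; exact hz))
  obtain ⟨ε, hε, hε0⟩ :=
    ((hev.filter_mono nhdsWithin_le_nhds).and (self_mem_nhdsWithin (s := Set.Ioi (0 : ℝ)))).exists
  refine ⟨ε, hε0, ?_⟩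
  have := interior_subset hε
  simp only [f, Set.mem_preimage, AffineMap.lineMap_apply, vsub_eq_sub, vadd_eq_add] at this
  convert this using 1
  module

theorem exists_relCore [FiniteDimensional ℝ E] {D : Set E} (hD : Convex ℝ D) (hne : D.Nonempty) :
    ∃ x, RelCore D x := by
  obtain ⟨x, hx⟩ := hne.intrinsicInterior hD
  exact ⟨x, intrinsicInterior_subset hx, fun d hd =>
    exists_pos_add_smul_mem_of_mem_intrinsicInterior hx (subset_affineSpan ℝ D hd)⟩

/-- The cone generated by the pairs `(d - s, t)` with `d ∈ D`, `s ∈ S` and `φ d - φ x ≤ t`. -/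
def differenceEpigraphCone {D S : Set E} {φ : E → ℝ} (hφ : ConvexOn ℝ D φ) (hS : Convex ℝ S)
    {x : E} (hxD : x ∈ D) (hxS : x ∈ S) : PointedCone ℝ (E × ℝ) where
  carrier := {p | ∃ c : ℝ, 0 < c ∧ ∃ d ∈ D, ∃ s ∈ S, p.1 = c • (d - s) ∧ c * (φ d - φ x) ≤ p.2}
  zero_mem' := ⟨1, one_pos, x, hxD, x, hxS, by simp, by simp⟩
  add_mem' := by
    rintro p q ⟨c, hc, d, hd, s, hs, hp, hpt⟩ ⟨c', hc', d', hd', s', hs', hq, hqt⟩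
    have hk : 0 < c + c' := by positivity
    have h1 : c / (c + c') + c' / (c + c') = 1 := by field_simp
    have h0 : 0 ≤ c / (c + c') := by positivity
    have h0' : 0 ≤ c' / (c + c') := by positivity
    refine ⟨c + c', hk, _, hφ.1 hd hd' h0 h0' h1, _, hS hs hs' h0 h0' h1, ?_, ?_⟩
    · rw [Prod.fst_add, hp, hq]
      match_scalars <;> field_simp
    · have h := mul_le_mul_of_nonneg_left (hφ.2 hd hd' h0 h0' h1) hk.le
      have e : (c + c') * ((c / (c + c')) • φ d + (c' / (c + c')) • φ d') = c * φ d + c' * φ d' := by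
        simp only [smul_eq_mul]
        field_simp
      rw [Prod.snd_add]
      linarith
  smul_mem' := by
    rintro ⟨a, ha⟩ p ⟨c, hc, d, hd, s, hs, hp, hpt⟩
    rcases ha.eq_or_lt with rfl | ha
    · refine ⟨1, one_pos, x, hxD, x, hxS, ?_, ?_⟩ <;> simp
    · refine ⟨a * c, by positivity, d, hd, s, hs, ?_, ?_⟩
      · simp [hp, mul_smul]
      · have := mul_le_mul_of_nonneg_left hpt ha.le
        simpa [NNReal.smul_def, mul_assoc] using this

/-- If a convex `φ` attains its minimum over `S` at `x` and zero is a relative algebraic interior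
point of `D - S`, then there is a subgradient of `φ` at `x` whose negative is normal to `S`. -/
theorem exists_multiplier [FiniteDimensional ℝ E] {D S : Set E} {φ : E → ℝ}
    (hφ : ConvexOn ℝ D φ) (hS : Convex ℝ S)
    (hDS : ∀ d ∈ D, ∀ s ∈ S, ∃ ε : ℝ, 0 < ε ∧ ∃ d' ∈ D, ∃ s' ∈ S, d' - s' = -(ε • (d - s)))
    {x : E} (hxD : x ∈ D) (hxS : x ∈ S) (hmin : ∀ y ∈ S, y ∈ D → φ x ≤ φ y) :
    ∃ v : E, ∀ d ∈ D, ∀ s ∈ S, φ x + inner ℝ v (d - s) ≤ φ d := by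
  let K := differenceEpigraphCone hφ hS hxD hxS
  have mem_K (p : E × ℝ) : p ∈ K ↔ ∃ c : ℝ, 0 < c ∧ ∃ d ∈ D, ∃ s ∈ S,
      p.1 = c • (d - s) ∧ c * (φ d - φ x) ≤ p.2 := Iff.rfl
  let W : Submodule ℝ E := Submodule.span ℝ (D - S)
  have hsub (d) (hd : d ∈ D) (s) (hs : s ∈ S) : d - s ∈ W :=
    Submodule.subset_span ⟨d, hd, s, hs, rfl⟩
  -- `hDS` makes the projection of `K` to `E` symmetric, so it is all of `W`.
  have hcone (w : E) (hw : w ∈ W) : ∃ t : ℝ, (w, t) ∈ K := by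
    have hpos (w : E) (t a : ℝ) (ha : 0 ≤ a) (h : (w, t) ∈ K) : ∃ t' : ℝ, (a • w, t') ∈ K :=
      ⟨a * t, K.smul_mem ha h⟩
    have key : ∀ w ∈ W, (∃ t : ℝ, (w, t) ∈ K) ∧ ∃ t : ℝ, (-w, t) ∈ K := by
      intro w hw
      induction hw using Submodule.span_induction with
      | mem w h =>
        obtain ⟨d, hd, s, hs, rfl⟩ := h
        obtain ⟨ε, hε, d', hd', s', hs', h⟩ := hDS d hd s hs
        refine ⟨⟨_, (mem_K _).2 ⟨1, one_pos, d, hd, s, hs, (one_smul _ _).symm, le_rfl⟩⟩,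
          ⟨_, (mem_K _).2 ⟨ε⁻¹, by positivity, d', hd', s', hs', ?_, le_rfl⟩⟩⟩
        rw [h, smul_neg, inv_smul_smul₀ hε.ne']
      | zero => exact ⟨⟨0, K.zero_mem⟩, ⟨0, by rw [neg_zero]; exact K.zero_mem⟩⟩
      | add y z _ _ hy hz =>
        obtain ⟨⟨t, ht⟩, ⟨t', ht'⟩⟩ := hy
        obtain ⟨⟨r, hr⟩, ⟨r', hr'⟩⟩ := hz
        exact ⟨⟨_, K.add_mem ht hr⟩, ⟨_, by rw [neg_add]; exact K.add_mem ht' hr'⟩⟩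
      | smul a y _ hy =>
        obtain ⟨⟨t, ht⟩, ⟨t', ht'⟩⟩ := hy
        rcases le_total 0 a with ha | ha
        · exact ⟨hpos _ _ a ha ht, by rw [← smul_neg]; exact hpos _ _ a ha ht'⟩
        · have ha' : 0 ≤ -a := by linarith
          refine ⟨?_, ?_⟩
          · simpa using hpos _ _ (-a) ha' ht'
          · simpa using hpos _ _ (-a) ha' ht
    exact (key w hw).1
  -- The factor `Wᗮ` supplies the directions that `K` misses, so that every vector can be translated
  -- into `K`. It meets `W` only in zero, where minimality of `x` gives positivity.
  let f : E × ℝ →ₗ.[ℝ] ℝ := ⟨Wᗮ.prod ⊤, (LinearMap.snd ℝ E ℝ).comp (Wᗮ.prod ⊤).subtype⟩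
  have hf (p : f.domain) : f p = (p : E × ℝ).2 := rfl
  obtain ⟨g, hgf, hgK⟩ := riesz_extension K f
    (by
      rintro ⟨⟨u, t⟩, hu, ht⟩ hK
      obtain ⟨c, hc, d, hd, s, hs, h, hle⟩ := (mem_K _).1 hK
      have hu0 : u = 0 := by
        have huW : u ∈ W := by
          rw [show u = c • (d - s) from h]
          exact W.smul_mem _ (hsub d hd s hs)
        exact inner_self_eq_zero.1 (hu u huW)
      have hds : d = s := by
        have : c • (d - s) = 0 := by rw [← h]; exact hu0
        exact sub_eq_zero.1 ((smul_eq_zero.1 this).resolve_left hc.ne')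
      subst hds
      rw [hf]
      have := hmin d hs hd
      exact le_trans (mul_nonneg hc.le (by linarith)) hle)
    (by
      rintro ⟨y, r⟩
      obtain ⟨w, hw, u, hu, rfl⟩ := W.exists_add_mem_mem_orthogonal y
      obtain ⟨t, ht⟩ := hcone w hw
      refine ⟨⟨(-u, t - r), Wᗮ.neg_mem hu, trivial⟩, ?_⟩
      convert ht using 1
      ext <;> simp)
  let ℓ : E →L[ℝ] ℝ := LinearMap.toContinuousLinearMap (g.comp (LinearMap.inl ℝ E ℝ))
  refine ⟨-(InnerProductSpace.toDual ℝ E).symm ℓ, fun d hd s hs => ?_⟩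
  have h1 := hgK (d - s, φ d - φ x)
    ((mem_K _).2 ⟨1, one_pos, d, hd, s, hs, (one_smul _ _).symm, by simp⟩)
  have h2 : g (0, φ d - φ x) = φ d - φ x :=
    hgf ⟨(0, φ d - φ x), Wᗮ.zero_mem, trivial⟩
  have h3 : g (d - s, φ d - φ x) = g (d - s, 0) + g (0, φ d - φ x) := by
    rw [← map_add]; simp
  have h4 : inner ℝ ((InnerProductSpace.toDual ℝ E).symm ℓ) (d - s) = g (d - s, 0) := by
    rw [InnerProductSpace.toDual_symm_apply]; rfl
  rw [inner_neg_left, h4]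
  linarith

end Convexity

/-! ### Subdifferentials and the qualification condition -/

variable {n : ℕ}

/-- A convex function is subdifferentiable on the relative algebraic interior of its domain. -/
theorem RelCore.mem_svDom_subdiff {D : Set (EuclideanSpace ℝ (Fin n))}
    {φ : EuclideanSpace ℝ (Fin n) → ℝ} (hφ : ConvexOn ℝ D φ) {x : EuclideanSpace ℝ (Fin n)}
    (hx : RelCore D x) : x ∈ svDom (subdiff D φ) := by
  obtain ⟨v, hv⟩ := exists_multiplier hφ (convex_singleton x)
    (by
      rintro d hd s rfl
      obtain ⟨ε, hε, h⟩ := hx.2 d hd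
      exact ⟨ε, hε, _, h, s, rfl, by module⟩)
    hx.1 rfl (by rintro y rfl -; exact le_rfl)
  exact ⟨v, hx.1, fun y hy => hv y hy x rfl⟩

/-- If zero is in the relative interior of `dom ∂φ - S`, then it is a relative algebraic interior
point of `D - S`. -/
theorem exists_neg_smul_mem_sub {D S : Set (EuclideanSpace ℝ (Fin n))}
    {φ : EuclideanSpace ℝ (Fin n) → ℝ} (hφ : ConvexOn ℝ D φ)
    (hri : (0 : EuclideanSpace ℝ (Fin n)) ∈ intrinsicInterior ℝ (svDom (subdiff D φ) - S))
    {d s : EuclideanSpace ℝ (Fin n)} (hd : d ∈ D) (hs : s ∈ S) :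
    ∃ ε : ℝ, 0 < ε ∧ ∃ d' ∈ D, ∃ s' ∈ S, d' - s' = -(ε • (d - s)) := by
  obtain ⟨x, hx⟩ := exists_relCore hφ.1 ⟨d, hd⟩
  have hm := hx.combo hφ.1 hd (a := 1 / 2) (b := 1 / 2) (by norm_num) (by norm_num) (by norm_num)
  -- There may be no subgradient at `d`, but there are some at `x` and at the midpoint of `x` and
  -- `d`; their line passes through `d` at parameter 2.
  have hspan : d - s ∈ affineSpan ℝ (svDom (subdiff D φ) - S) := by
    have := AffineMap.lineMap_mem (k := ℝ) 2
      (subset_affineSpan ℝ _ (Set.sub_mem_sub (hx.mem_svDom_subdiff hφ) hs))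
      (subset_affineSpan ℝ _ (Set.sub_mem_sub (hm.mem_svDom_subdiff hφ) hs))
    convert this using 1
    simp only [AffineMap.lineMap_apply, vsub_eq_sub, vadd_eq_add]
    module
  obtain ⟨ε, hε, d', ⟨v, hv⟩, s', hs', h⟩ :=
    exists_pos_add_smul_mem_of_mem_intrinsicInterior hri hspan
  exact ⟨ε, hε, d', hv.1, s', hs', h.trans (by module)⟩

/-! ### The variational inequality and minimizers over its solution set -/

/-- Minty's lemma. -/
theorem mem_solVI_iff_minty {Ω : Set (EuclideanSpace ℝ (Fin n))}
    {F : EuclideanSpace ℝ (Fin n) → EuclideanSpace ℝ (Fin n)} (hΩ : Convex ℝ Ω)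
    (hF : ContinuousOn F Ω) (hmono : MonotoneMapOn F Ω) {x : EuclideanSpace ℝ (Fin n)} :
    x ∈ solVI F Ω ↔ x ∈ Ω ∧ ∀ y ∈ Ω, 0 ≤ inner ℝ (F y) (y - x) := by
  refine ⟨fun h => ⟨h.1, fun y hy => ?_⟩, fun h => ⟨h.1, fun y hy => ?_⟩⟩
  · have h1 := hmono y hy x h.1
    rw [inner_sub_left] at h1
    linarith [h.2 y hy]
  -- Test the Minty inequality on the segment from `x` to `y`, divide by `t` and let `t → 0`.
  · let c : ℝ → EuclideanSpace ℝ (Fin n) := fun t => x + t • (y - x)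
    have hc (t : ℝ) (ht : t ∈ Set.Icc (0 : ℝ) 1) : c t ∈ Ω := hΩ.add_smul_sub_mem h.1 hy ht
    have hc0 : c 0 = x := by simp [c]
    have hcont : ContinuousOn (fun t => inner ℝ (F (c t)) (y - x)) (Set.Icc (0 : ℝ) 1) := by
      refine ContinuousOn.inner (hF.comp (by fun_prop) hc) continuousOn_const
    have htend : Tendsto (fun t => inner ℝ (F (c t)) (y - x)) (𝓝[Set.Ioc (0 : ℝ) 1] 0)
        (𝓝 (inner ℝ (F x) (y - x))) := by
      have := (hcont 0 (by simp)).mono_left (nhdsWithin_mono 0 Set.Ioc_subset_Icc_self)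
      simpa [hc0] using this
    have : (𝓝[Set.Ioc (0 : ℝ) 1] 0).NeBot := by
      rw [nhdsWithin_Ioc_eq_nhdsGT one_pos]; infer_instance
    refine ge_of_tendsto htend ?_
    filter_upwards [self_mem_nhdsWithin] with t ht
    have h1 := h.2 (c t) (hc t ⟨ht.1.le, ht.2⟩)
    rw [show c t - x = t • (y - x) by simp [c], inner_smul_right] at h1
    exact nonneg_of_mul_nonneg_right h1 ht.1

/-- In Minty's form each constraint is affine in the unknown point. -/
theorem convex_solVI {Ω : Set (EuclideanSpace ℝ (Fin n))}
    {F : EuclideanSpace ℝ (Fin n) → EuclideanSpace ℝ (Fin n)} (hΩ : Convex ℝ Ω)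
    (hF : ContinuousOn F Ω) (hmono : MonotoneMapOn F Ω) : Convex ℝ (solVI F Ω) := by
  intro x hx y hy a b ha hb hab
  rw [mem_solVI_iff_minty hΩ hF hmono] at hx hy ⊢
  refine ⟨hΩ hx.1 hy.1 ha hb hab, fun z hz => ?_⟩
  have h : z - (a • x + b • y) = a • (z - x) + b • (z - y) := by
    obtain rfl : b = 1 - a := by linarith
    module
  rw [h, inner_add_right, inner_smul_right, inner_smul_right]
  exact add_nonneg (mul_nonneg ha (hx.2 z hz)) (mul_nonneg hb (hy.2 z hz))

/-- Under the qualification condition, the solutions of `GVI(∂φ, S)` are the minimizers of `φ` on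
`S`. -/
theorem solGVI_subdiff_eq_argminOn {D S : Set (EuclideanSpace ℝ (Fin n))}
    {φ : EuclideanSpace ℝ (Fin n) → ℝ} (hφ : ConvexOn ℝ D φ) (hS : Convex ℝ S) (hSD : S ⊆ D)
    (hri : (0 : EuclideanSpace ℝ (Fin n)) ∈ intrinsicInterior ℝ (svDom (subdiff D φ) - S)) :
    solGVI (subdiff D φ) S = argminOn φ S := by
  ext x
  constructor
  · rintro ⟨hx, v, hv, h⟩
    exact ⟨hx, fun y hy => by linarith [hv.2 y (hSD hy), h y hy]⟩
  · rintro ⟨hx, h⟩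
    obtain ⟨v, hv⟩ := exists_multiplier hφ hS
      (fun d hd s hs => exists_neg_smul_mem_sub hφ hri hd hs) (hSD hx) hx (fun y hy _ => h y hy)
    refine ⟨hx, v, ⟨hSD hx, fun y hy => hv y hy x hx⟩, fun y hy => ?_⟩
    have := hv x (hSD hx) y hy
    rw [← neg_sub, inner_neg_right] at this
    linarith

theorem convex_argminOn {S : Set (EuclideanSpace ℝ (Fin n))}
    {φ : EuclideanSpace ℝ (Fin n) → ℝ} (hφ : ConvexOn ℝ S φ) : Convex ℝ (argminOn φ S) := by
  intro x hx y hy a b ha hb hab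
  refine ⟨hφ.1 hx.1 hy.1 ha hb hab, fun z hz => ?_⟩
  calc φ (a • x + b • y) ≤ a • φ x + b • φ y := hφ.2 hx.1 hy.1 ha hb hab
    _ ≤ a • φ z + b • φ z := by
        gcongr
        · exact hx.2 z hz
        · exact hy.2 z hz
    _ = φ z := by rw [← add_smul, hab, one_smul]

/-- Under the qualification condition, `S` meets the relative algebraic interior of `D`. -/
theorem exists_mem_relCore {D S : Set (EuclideanSpace ℝ (Fin n))}
    {φ : EuclideanSpace ℝ (Fin n) → ℝ} (hφ : ConvexOn ℝ D φ) (hS : Convex ℝ S) (hSD : S ⊆ D)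
    (hne : S.Nonempty)
    (hri : (0 : EuclideanSpace ℝ (Fin n)) ∈ intrinsicInterior ℝ (svDom (subdiff D φ) - S)) :
    ∃ x ∈ S, RelCore D x := by
  obtain ⟨s, hs⟩ := hne
  obtain ⟨x, hx⟩ := exists_relCore hφ.1 ⟨s, hSD hs⟩
  obtain ⟨ε, hε, d', hd', s', hs', h⟩ := exists_neg_smul_mem_sub hφ hri hx.1 hs
  have h1 : ε / (1 + ε) + 1 / (1 + ε) = 1 := by field_simp; ring
  -- Rearranged, `h` reads `d' + ε • x = s' + ε • s`; dividing by `1 + ε` gives one point that lies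
  -- in `S` and in the relative core.
  refine ⟨_, hS hs hs' (by positivity) (by positivity) h1, ?_⟩
  have hc := hx.combo hφ.1 hd' (a := ε / (1 + ε)) (b := 1 / (1 + ε))
    (by positivity) (by positivity) h1
  convert hc using 1
  obtain rfl : d' = s' + -(ε • (x - s)) := by rw [← h]; abel
  match_scalars <;> field_simp <;> ring

/-! ### Recession directions and boundedness -/

/-- If no subgradient of `φ` at points of `S` has positive product with the recession direction `w`,
then `φ` does not increase along `w`. -/
theorem le_of_forall_inner_subdiff_nonpos {D S : Set (EuclideanSpace ℝ (Fin n))}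
    {φ : EuclideanSpace ℝ (Fin n) → ℝ} (hφ : ConvexOn ℝ D φ) (hS : Convex ℝ S) (hSD : S ⊆ D)
    (hcont : ContinuousOn φ S)
    (hri : (0 : EuclideanSpace ℝ (Fin n)) ∈ intrinsicInterior ℝ (svDom (subdiff D φ) - S))
    {w : EuclideanSpace ℝ (Fin n)} (hw : w ∈ recessionCone S)
    (hsub : ∀ x ∈ S, ∀ v ∈ subdiff D φ x, inner ℝ v w ≤ 0)
    {x : EuclideanSpace ℝ (Fin n)} (hx : x ∈ S) {τ : ℝ} (hτ : 0 ≤ τ) :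
    φ (x + τ • w) ≤ φ x := by
  obtain ⟨z, hzS, hz⟩ := exists_mem_relCore hφ hS hSD ⟨x, hx⟩ hri
  have hlim (y : EuclideanSpace ℝ (Fin n)) (hy : y ∈ S) :
      Tendsto (fun t : ℝ => φ (t • z + (1 - t) • y)) (𝓝[Set.Ioc (0 : ℝ) 1] 0) (𝓝 (φ y)) := by
    have h1 : ContinuousOn (fun t : ℝ => φ (t • z + (1 - t) • y)) (Set.Icc (0 : ℝ) 1) :=
      hcont.comp (by fun_prop) fun t ht => hS hzS hy ht.1 (by linarith [ht.2]) (by ring)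
    have := (h1 0 (by simp)).mono_left (nhdsWithin_mono 0 Set.Ioc_subset_Icc_self)
    simpa using this
  have : (𝓝[Set.Ioc (0 : ℝ) 1] (0 : ℝ)).NeBot := by
    rw [nhdsWithin_Ioc_eq_nhdsGT one_pos]; infer_instance
  have hxw := hw x hx τ hτ
  refine le_of_tendsto_of_tendsto (hlim _ hxw) (hlim x hx) ?_
  -- Shifted towards `z`, both ends of the step differ by a multiple of `w`, and the far end has a
  -- subgradient to compare them with.
  filter_upwards [self_mem_nhdsWithin] with t ht
  have ht' : 0 ≤ 1 - t := by linarith [ht.2]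
  have hc := hz.combo hφ.1 (hSD hxw) ht.1 ht' (by ring)
  obtain ⟨v, hv⟩ := hc.mem_svDom_subdiff hφ
  have h1 := hv.2 _ (hSD (hS hzS hx ht.1.le ht' (by ring)))
  have h2 := hsub _ (hS hzS hxw ht.1.le ht' (by ring)) v hv
  have h3 : t • z + (1 - t) • x - (t • z + (1 - t) • (x + τ • w)) = -(((1 - t) * τ) • w) := by
    module
  rw [h3, inner_neg_right, inner_smul_right] at h1
  nlinarith [mul_nonneg ht' hτ]

/-- If every nonzero recession direction of a closed convex set `S` has positive product with some
subgradient of `φ` at a point of `S`, then the sublevel sets of `φ` on `S` are bounded. -/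
theorem isBounded_sublevel {D S : Set (EuclideanSpace ℝ (Fin n))}
    {φ : EuclideanSpace ℝ (Fin n) → ℝ} (hS : Convex ℝ S) (hSc : IsClosed S) (hSD : S ⊆ D)
    (hpos : ∀ w ∈ recessionCone S, w ≠ 0 → ∃ x ∈ S, ∃ v ∈ subdiff D φ x, 0 < inner ℝ v w)
    (r : ℝ) : Bornology.IsBounded {x | x ∈ S ∧ φ x ≤ r} := by
  by_contra hb
  obtain ⟨w, hw0, hw⟩ := not_bounded_iff_exists_ne_zero_mem_asymptoticCone.1 hb
  have hwS : w ∈ recessionCone S := fun x hx τ hτ => by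
    have := hS.smul_vadd_mem_of_isClosed_of_mem_asymptoticCone hSc hτ
      (asymptoticCone_mono (fun y hy => hy.1) hw) hx
    rwa [vadd_eq_add, add_comm] at this
  obtain ⟨x, hx, v, hv, hvw⟩ := hpos w hwS hw0
  -- The sublevel set need not be closed or convex here, so `w` is used as an asymptotic direction
  -- of a closed half-space containing it.
  let H : Set (EuclideanSpace ℝ (Fin n)) := {y | inner ℝ v y ≤ r - φ x + inner ℝ v x}
  have hsub : {y | y ∈ S ∧ φ y ≤ r} ⊆ H := fun y hy => by
    have := hv.2 y (hSD hy.1)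
    rw [inner_sub_right] at this
    change inner ℝ v y ≤ r - φ x + inner ℝ v x
    linarith [hy.2]
  have hHconv : Convex ℝ H := convex_halfSpace_le (innerSL ℝ v).isLinear _
  have hHc : IsClosed H := isClosed_le (by fun_prop) continuous_const
  obtain ⟨y, hy⟩ : ({y | y ∈ S ∧ φ y ≤ r}).Nonempty := by
    by_contra hne
    rw [Set.not_nonempty_iff_eq_empty] at hne
    exact hb (hne ▸ Bornology.isBounded_empty)
  have hyH := hsub hy
  set c := r - φ x + inner ℝ v x with hcdef
  have hyc : inner ℝ v y ≤ c := hyH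
  -- This step brings the inner product with `v` to `c + 1`, outside `H`.
  have hτ : 0 ≤ (c - inner ℝ v y + 1) / inner ℝ v w := div_nonneg (by linarith) hvw.le
  have hmem := hHconv.smul_vadd_mem_of_isClosed_of_mem_asymptoticCone hHc hτ
    (asymptoticCone_mono hsub hw) hyH
  have hmem' : inner ℝ v (((c - inner ℝ v y + 1) / inner ℝ v w) • w + y) ≤ c := hmem
  rw [inner_add_right, inner_smul_right, div_mul_cancel₀ _ hvw.ne'] at hmem'
  linarith

end VarIneq

/-- `D ⊇ Ω` is the effective domain of the convex function `φ` (which is `+∞` outside `D`);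
`D = Ω` is the case of a function given on `Ω` only. Relative interior is `intrinsicInterior`,
and the difference of sets is the Minkowski difference. -/
theorem mainTheorem12 {n : ℕ}
    (Ω D : Set (EuclideanSpace ℝ (Fin n)))
    (F : EuclideanSpace ℝ (Fin n) → EuclideanSpace ℝ (Fin n))
    (φ : EuclideanSpace ℝ (Fin n) → ℝ)
    (hΩ_ne : Ω.Nonempty) (hΩ_closed : IsClosed Ω) (hΩ_conv : Convex ℝ Ω)
    (hF_cont : ContinuousOn F Ω) (hF_mono : VarIneq.MonotoneMapOn F Ω)
    (hΩD : Ω ⊆ D) (hφ_conv : ConvexOn ℝ D φ) (hφ_cont : ContinuousOn φ Ω)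
    (hri_Ω : (0 : EuclideanSpace ℝ (Fin n)) ∈
      intrinsicInterior ℝ (VarIneq.svDom (VarIneq.subdiff D φ) - Ω))
    (hS_ne : (VarIneq.solVI F Ω).Nonempty) (hS_closed : IsClosed (VarIneq.solVI F Ω))
    (hri_S : (0 : EuclideanSpace ℝ (Fin n)) ∈
      intrinsicInterior ℝ (VarIneq.svDom (VarIneq.subdiff D φ) - VarIneq.solVI F Ω)) :
    VarIneq.solGVI (VarIneq.subdiff D φ) (VarIneq.solVI F Ω) =
        VarIneq.argminOn φ (VarIneq.solVI F Ω) ∧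
      (((VarIneq.solGVI (VarIneq.subdiff D φ) (VarIneq.solVI F Ω)).Nonempty ∧
          Bornology.IsBounded (VarIneq.solGVI (VarIneq.subdiff D φ) (VarIneq.solVI F Ω)) ∧
          Convex ℝ (VarIneq.solGVI (VarIneq.subdiff D φ) (VarIneq.solVI F Ω))) ↔
        ∀ w ∈ VarIneq.recessionCone (VarIneq.solVI F Ω), w ≠ 0 →
          ∃ x ∈ VarIneq.solVI F Ω, ∃ v ∈ VarIneq.subdiff D φ x, 0 < inner ℝ v w) := by

  have hS := VarIneq.convex_solVI hΩ_conv hF_cont hF_mono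
  have hSΩ : VarIneq.solVI F Ω ⊆ Ω := fun x hx => hx.1
  have hSD := hSΩ.trans hΩD
  have hcont := hφ_cont.mono hSΩ
  have heq := VarIneq.solGVI_subdiff_eq_argminOn hφ_conv hS hSD hri_S
  refine ⟨heq, ?_⟩
  rw [heq]
  constructor
  · rintro ⟨⟨x, hx⟩, hb, -⟩ w hw hw0
    by_contra! hsub
    obtain ⟨R, hR⟩ := hb.exists_norm_le
    -- The whole ray from `x` along `w` consists of minimizers.
    have hmem (τ : ℝ) (hτ : 0 ≤ τ) : ‖x + τ • w‖ ≤ R :=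
      hR _ ⟨hw x hx.1 τ hτ, fun y hy =>
        (VarIneq.le_of_forall_inner_subdiff_nonpos hφ_conv hS hSD hcont hri_S hw hsub hx.1 hτ).trans
          (hx.2 y hy)⟩
    have hwn : 0 < ‖w‖ := norm_pos_iff.2 hw0
    have hR0 : 0 ≤ R := (norm_nonneg _).trans (hmem 0 le_rfl)
    have hτ : 0 ≤ (R + ‖x‖ + 1) / ‖w‖ := by positivity
    have h1 := hmem _ hτ
    have h2 := norm_sub_le (x + ((R + ‖x‖ + 1) / ‖w‖) • w) x
    rw [add_sub_cancel_left, norm_smul, Real.norm_of_nonneg hτ, div_mul_cancel₀ _ hwn.ne'] at h2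
    linarith
  · intro hpos
    have hbdd := VarIneq.isBounded_sublevel hS hS_closed hSD hpos
    obtain ⟨x₀, hx₀⟩ := hS_ne
    refine ⟨?_, ?_, VarIneq.convex_argminOn (hφ_conv.subset hSD hS)⟩
    · have hclosed : IsClosed {x | x ∈ VarIneq.solVI F Ω ∧ φ x ≤ φ x₀} :=
        hcont.preimage_isClosed_of_isClosed hS_closed isClosed_Iic
      obtain ⟨x, hx, hmin⟩ := (Metric.isCompact_of_isClosed_isBounded hclosed
        (hbdd (φ x₀))).exists_isMinOn ⟨x₀, hx₀, le_rfl⟩ (hcont.mono fun y hy => hy.1)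
      refine ⟨x, hx.1, fun y hy => ?_⟩
      rcases le_total (φ y) (φ x₀) with h | h
      · exact hmin ⟨hy, h⟩
      · exact hx.2.trans h
    · exact (hbdd (φ x₀)).subset fun y hy => ⟨hy.1, hy.2 x₀ hx₀⟩
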